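/- Let $T_\infty$ be the infinite binary rooted tree whose nodes are the finite words in the letters $a,b$; the root is the empty word and the two nodes above a node $x$ are $xa$ and $xb$. Let $\mathrm{Aut}(T_\infty)$ be the group of automorphisms of this rooted tree, with the profinite topology (the coarsest topology for which the restriction maps to the discrete finite groups $\mathrm{Aut}(T_n)$ are continuous, where $T_n$ is the subtree of words of length at most $n$). For $\sigma\in\mathrm{Aut}(T_\infty)$ and a node $x$, put $\mathrm{Par}(\sigma,x)=0$ if $\sigma(xa)=\sigma(x)a$ and $\sigma(xb)=\sigma(x)b$, and $\mathrm{Par}(\sigma,x)=1$ if $\sigma(xa)=\sigma(x)b$ and $\sigma(xb)=\sigma(x)a$. Define, in $\mathbb{Z}/2\mathbb{Z}$, $$P^a_{3,2}(\sigma,x)=\sum_{w\in\{a,b\}^2}\mathrm{Par}(\sigma,xaw)+\sum_{w'\in\{a,b\}}\mathrm{Par}(\sigma,xbw'),\qquad P^b_{3,2}(\sigma,x)=\sum_{w\in\{a,b\}^2}\mathrm{Par}(\sigma,xbw)+\sum_{w'\in\{a,b\}}\mathrm{Par}(\sigma,xaw'),$$ $$R_{3,2}(\sigma,x)=\sum_{w\in\{a,b\}^2}\Big[\mathrm{Par}(\sigma,xw)+\mathrm{Par}(\sigma,xwb)+\sum_{t\in\{a,b\}}\mathrm{Par}(\sigma,xwat)\Big]+\big[\mathrm{Par}(\sigma,xaa)+\mathrm{Par}(\sigma,xab)\big]\big[\mathrm{Par}(\sigma,xba)+\mathrm{Par}(\sigma,xbb)\big].$$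 Let $M_{3,2,\infty}$ be the set of $\sigma\in\mathrm{Aut}(T_\infty)$ for which $P^a_{3,2}(\sigma,x_1)=P^b_{3,2}(\sigma,x_1)=P^a_{3,2}(\sigma,x_2)=P^b_{3,2}(\sigma,x_2)$ for all nodes $x_1,x_2$; write $P_{3,2}(\sigma)$ for this common value, and let $B_{3,2,\infty}=\{\sigma\in M_{3,2,\infty}: P_{3,2}(\sigma)=0\}$. Let $\tilde M_{3,2,\infty}$ be the set of $\sigma\in M_{3,2,\infty}$ for which $R_{3,2}(\sigma,x_1)=R_{3,2}(\sigma,x_2)$ for all nodes $x_1,x_2$; write $R_{3,2}(\sigma)$ for this common value, and let $\tilde B_{3,2,\infty}=\{\sigma\in\tilde M_{3,2,\infty}\cap B_{3,2,\infty}: R_{3,2}(\sigma)=0\}$. Let $\tau\in\mathrm{Aut}(T_\infty)$ be the automorphism that swaps the two subtrees rooted at $a$ and $b$, that is, $\mathrm{Par}(\tau,x)=1$ if $x$ is the root and $0$ otherwise. For $\alpha,\beta\in\mathrm{Aut}(T_\infty)$ let $(\alpha,\beta)$ be the automorphism that fixes the nodes $a$ and $b$ and acts as $\alpha$ on the subtree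 rooted at $a$ and as $\beta$ on the subtree rooted at $b$. Let $\alpha_1=\tau$, $\alpha_2=(\tau,1)$, and let $\alpha_3$ be the unique automorphism with $\alpha_3=(\alpha_2,\alpha_3)$. Let $G^{\mathrm{Pink}}_{3,2,\infty}$ be the closure in $\mathrm{Aut}(T_\infty)$ of the subgroup generated by $\alpha_1,\alpha_2,\alpha_3$. **Theorem.** $G^{\mathrm{Pink}}_{3,2,\infty}=\tilde B_{3,2,\infty}$. -/

import Mathlib

namespace PinkTree

/-- Nodes of the infinite binary rooted tree: finite words in the two letters `a`, `b`, read from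
the root upwards. The root is the empty word, and the two nodes above `x` are `x ++ [a]` and
`x ++ [b]`. -/
abbrev Node : Type := List Bool

/-- The letter `a`. -/
abbrev a : Bool := false

/-- The letter `b`. -/
abbrev b : Bool := true

/-- Automorphisms of the rooted tree: the permutations of the nodes that fix the root and commute
with the map that sends a node to the node immediately below it (`List.dropLast` erases the last
letter of a word, and keeps the empty word). -/
def treeAut : Subgroup (Equiv.Perm Node) where
  carrier := {σ | σ [] = [] ∧ ∀ x : Node, σ x.dropLast = (σ x).dropLast}
  one_mem' := ⟨rfl, fun _ => rfl⟩
  mul_mem' := by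
    rintro σ τ ⟨hσ, hσ'⟩ ⟨hτ, hτ'⟩
    exact ⟨by simp [hσ, hτ], fun x => by simp [hσ', hτ']⟩
  inv_mem' := by
    rintro σ ⟨hσ, hσ'⟩
    refine ⟨by rw [Equiv.Perm.inv_eq_iff_eq, hσ], fun x => ?_⟩
    rw [Equiv.Perm.inv_eq_iff_eq, hσ', show σ (σ⁻¹ x) = x by simp]

/-- The group `Aut(T_∞)`; multiplication is composition, `(σ * τ) x = σ (τ x)`. -/
abbrev TreeAut : Type := treeAut

/-- The restriction of an automorphism to the finite subtree of the words of length at most `n`. -/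
def restrict (n : ℕ) (σ : TreeAut) : {x : Node // x.length ≤ n} → Node :=
  fun x => σ.1 x.1

/-- The profinite topology on `Aut(T_∞)`: the coarsest one for which the restrictions to all the
finite subtrees are continuous, where the restricted automorphisms carry the discrete topology. -/
instance : TopologicalSpace TreeAut :=
  ⨅ n : ℕ, TopologicalSpace.induced (restrict n) ⊥

/-- The parity of `σ` at the node `x`, modulo `2`: it is `0` if `σ (xa) = σ(x)a` (and hence
`σ (xb) = σ(x)b`), and `1` otherwise (and then `σ (xa) = σ(x)b` and `σ (xb) = σ(x)a`). -/
def par (σ : TreeAut) (x : Node) : ZMod 2 :=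
  if σ.1 (x ++ [a]) = σ.1 x ++ [a] then 0 else 1

/-- `∑_{w ∈ {a,b}^(r-1)} Par(σ, xaw) + ∑_{w' ∈ {a,b}^(s-1)} Par(σ, xbw')`, for `r > s ≥ 1`. -/
def Pa (r s : ℕ) (σ : TreeAut) (x : Node) : ZMod 2 :=
  (∑ w : Fin (r - 1) → Bool, par σ (x ++ [a] ++ List.ofFn w)) +
    ∑ w : Fin (s - 1) → Bool, par σ (x ++ [b] ++ List.ofFn w)

/-- `∑_{w ∈ {a,b}^(r-1)} Par(σ, xbw) + ∑_{w' ∈ {a,b}^(s-1)} Par(σ, xaw')`, for `r > s ≥ 1`. -/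
def Pb (r s : ℕ) (σ : TreeAut) (x : Node) : ZMod 2 :=
  (∑ w : Fin (r - 1) → Bool, par σ (x ++ [b] ++ List.ofFn w)) +
    ∑ w : Fin (s - 1) → Bool, par σ (x ++ [a] ++ List.ofFn w)

/-- The set `M_{r,s,∞}`. -/
def M (r s : ℕ) : Set TreeAut :=
  {σ | ∀ x₁ x₂ : Node, Pa r s σ x₁ = Pb r s σ x₁ ∧ Pb r s σ x₁ = Pa r s σ x₂ ∧
    Pa r s σ x₂ = Pb r s σ x₂}

/-- The common value of `Pa r s σ x` and `Pb r s σ x` over all nodes `x`, for `σ ∈ M r s`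
(read off at the root). -/
def P (r s : ℕ) (σ : TreeAut) : ZMod 2 := Pa r s σ []

/-- The set `B_{r,s,∞}`. -/
def B (r s : ℕ) : Set TreeAut := {σ | σ ∈ M r s ∧ P r s σ = 0}

/-- The function `R_{3,2}(σ, x)`. -/
def R (σ : TreeAut) (x : Node) : ZMod 2 :=
  (∑ w : Fin 2 → Bool,
    (par σ (x ++ List.ofFn w) + par σ (x ++ List.ofFn w ++ [b]) +
      ∑ t : Bool, par σ (x ++ List.ofFn w ++ [a, t]))) +
  (par σ (x ++ [a, a]) + par σ (x ++ [a, b])) * (par σ (x ++ [b, a]) + par σ (x ++ [b, b]))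

/-- The set `M̃_{3,2,∞}`. -/
def Mtilde : Set TreeAut := {σ | σ ∈ M 3 2 ∧ ∀ x₁ x₂ : Node, R σ x₁ = R σ x₂}

/-- The common value of `R σ x` over all nodes `x`, for `σ ∈ Mtilde` (read off at the root). -/
def Rval (σ : TreeAut) : ZMod 2 := R σ []

/-- The set `B̃_{3,2,∞}`. -/
def Btilde : Set TreeAut := {σ | σ ∈ Mtilde ∩ B 3 2 ∧ Rval σ = 0}

/-- The underlying map of `τ`: it exchanges the two subtrees above the root. -/
def swapFun : Node → Node
  | [] => []
  | t :: w => (!t) :: w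

/-- The underlying map of `(α, β)`. -/
def pairFun (α β : Node → Node) : Node → Node
  | [] => []
  | false :: w => a :: α w
  | true :: w => b :: β w

/-- The automorphism `τ` that exchanges the two subtrees above the root. -/
def tau : TreeAut :=
  ⟨{ toFun := swapFun
     invFun := swapFun
     left_inv := by rintro (_ | ⟨t, w⟩) <;> simp [swapFun]
     right_inv := by rintro (_ | ⟨t, w⟩) <;> simp [swapFun] },
   rfl, by rintro (_ | ⟨t, _ | ⟨u, w⟩⟩) <;> simp [swapFun]⟩

theorem apply_eq_nil (σ : TreeAut) (x : Node) : σ.1 x = [] ↔ x = [] := by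
  constructor
  · intro h
    exact σ.1.injective (h.trans σ.2.1.symm)
  · rintro rfl
    exact σ.2.1

/-- The automorphism `(α, β)` that fixes the two nodes of length one, and acts as `α` on the subtree
above `a` and as `β` on the subtree above `b`. -/
def pair (α β : TreeAut) : TreeAut :=
  ⟨{ toFun := pairFun α.1 β.1
     invFun := pairFun α.1.symm β.1.symm
     left_inv := by rintro (_ | ⟨_ | _, w⟩) <;> simp [pairFun]
     right_inv := by rintro (_ | ⟨_ | _, w⟩) <;> simp [pairFun] },
   rfl, by
    have key : ∀ (γ : TreeAut) (t u : Bool) (w : Node),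
        (t :: γ.1 (u :: w)).dropLast = t :: γ.1 (u :: w).dropLast := by
      intro γ t u w
      rw [List.dropLast_cons_of_ne_nil (by simp [apply_eq_nil]), γ.2.2]
    rintro (_ | ⟨_ | _, _ | ⟨u, w⟩⟩)
    · rfl
    · simp [pairFun, α.2.1]
    · simp [pairFun, key]
    · simp [pairFun, β.2.1]
    · simp [pairFun, key]⟩

/-- The generator `α₁ = τ`. -/
def alpha1 : TreeAut := tau

/-- The generator `α₂ = (τ, 1)`. -/
def alpha2 : TreeAut := pair tau 1

/-- The underlying map of `α₃`, by recursion on the length of the word. -/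
def alpha3Fun : Node → Node
  | [] => []
  | false :: w => a :: alpha2.1 w
  | true :: w => b :: alpha3Fun w

theorem alpha2_alpha2 (x : Node) : alpha2.1 (alpha2.1 x) = x := by
  rcases x with _ | ⟨_ | _, _ | ⟨t, w⟩⟩ <;> simp [alpha2, pair, pairFun, tau, swapFun]

theorem alpha3Fun_alpha3Fun (x : Node) : alpha3Fun (alpha3Fun x) = x := by
  induction x with
  | nil => rfl
  | cons t w ih => cases t <;> simp [alpha3Fun, alpha2_alpha2, ih]

theorem alpha3Fun_eq_nil (x : Node) : alpha3Fun x = [] ↔ x = [] := by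
  rcases x with _ | ⟨_ | _, w⟩ <;> simp [alpha3Fun]

theorem alpha3Fun_dropLast (x : Node) : alpha3Fun x.dropLast = (alpha3Fun x).dropLast := by
  induction x with
  | nil => rfl
  | cons t w ih =>
    rcases w with _ | ⟨u, w⟩
    · cases t <;> simp [alpha3Fun, alpha2.2.1]
    · cases t
      · rw [List.dropLast_cons_cons, alpha3Fun, alpha3Fun, alpha2.2.2,
          List.dropLast_cons_of_ne_nil (by simp [apply_eq_nil])]
      · rw [List.dropLast_cons_cons, alpha3Fun, alpha3Fun, ih,
          List.dropLast_cons_of_ne_nil (by simp [alpha3Fun_eq_nil])]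

/-- The generator `α₃`, which is the automorphism with `α₃ = (α₂, α₃)`. -/
def alpha3 : TreeAut :=
  ⟨{ toFun := alpha3Fun
     invFun := alpha3Fun
     left_inv := alpha3Fun_alpha3Fun
     right_inv := alpha3Fun_alpha3Fun },
   rfl, alpha3Fun_dropLast⟩

/-- `α₃` is the unique solution of its defining recursion. -/
theorem eq_pair_iff_eq_alpha3 (γ : TreeAut) : γ = pair alpha2 γ ↔ γ = alpha3 := by
  constructor
  · intro h
    apply Subtype.ext
    apply Equiv.ext
    intro x
    induction x with
    | nil => exact γ.2.1
    | cons t w ih =>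
      rw [h]
      cases t
      · rfl
      · exact congrArg (List.cons b) ih
  · rintro rfl
    apply Subtype.ext
    apply Equiv.ext
    rintro (_ | ⟨_ | _, w⟩) <;> rfl

theorem isOpen_eqOn (n : ℕ) (σ : TreeAut) :
    IsOpen {ρ : TreeAut | restrict n ρ = restrict n σ} := by
  have h : @Continuous TreeAut _ _ ⊥ (restrict n) := continuous_iff_le_induced.2 (iInf_le _ n)
  exact @IsOpen.preimage TreeAut _ _ ⊥ _ h {restrict n σ} trivial

theorem continuous_iff_restrict {X : Type*} [TopologicalSpace X] (f : X → TreeAut) :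
    Continuous f ↔ ∀ n x, ∀ᶠ y in nhds x, restrict n (f y) = restrict n (f x) := by
  constructor
  · intro h n x
    exact h.continuousAt.eventually ((isOpen_eqOn n (f x)).mem_nhds rfl)
  · intro h
    refine continuous_iInf_rng.2 fun n => continuous_induced_rng.2 ?_
    let _ : TopologicalSpace ({x : Node // x.length ≤ n} → Node) := ⊥
    have : DiscreteTopology ({x : Node // x.length ≤ n} → Node) := ⟨rfl⟩
    refine continuous_iff_continuousAt.2 fun x => ?_
    exact tendsto_nhds_of_eventually_eq (h n x)

theorem length_apply (σ : TreeAut) (x : Node) : (σ.1 x).length = x.length := by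
  induction x using List.reverseRecOn with
  | nil => rw [σ.2.1]
  | append_singleton x t ih =>
    have h := σ.2.2 (x ++ [t])
    rw [List.dropLast_concat] at h
    have h1 : (σ.1 (x ++ [t])).length ≠ 0 := by
      rw [Ne, List.length_eq_zero_iff, apply_eq_nil]
      simp
    have h2 := congrArg List.length h
    rw [List.length_dropLast, ih] at h2
    rw [List.length_append, List.length_singleton]
    omega

instance : IsTopologicalGroup TreeAut where
  continuous_mul := by
    refine (continuous_iff_restrict _).2 fun n p => ?_
    have h1 := (isOpen_eqOn n p.1).mem_nhds (show p.1 ∈ _ from rfl)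
    have h2 := (isOpen_eqOn n p.2).mem_nhds (show p.2 ∈ _ from rfl)
    filter_upwards [continuous_fst.continuousAt.eventually h1,
      continuous_snd.continuousAt.eventually h2] with q hq1 hq2
    funext x
    have e2 := congrFun hq2 x
    have e1 := congrFun hq1 ⟨p.2.1 x.1, by rw [length_apply]; exact x.2⟩
    simp only [restrict] at e1 e2
    simp only [restrict, Subgroup.coe_mul, Equiv.Perm.mul_apply, e1, e2]
  continuous_inv := by
    refine (continuous_iff_restrict _).2 fun n σ => ?_
    filter_upwards [(isOpen_eqOn n σ).mem_nhds (show σ ∈ _ from rfl)] with ρ hρ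
    funext x
    have e := congrFun hρ ⟨σ⁻¹.1 x.1, by rw [length_apply]; exact x.2⟩
    simp only [restrict] at e
    simp only [restrict]
    have h : σ.1 (σ⁻¹.1 x.1) = x.1 := by simp
    rw [h] at e
    calc ρ⁻¹.1 x.1 = ρ⁻¹.1 (ρ.1 (σ⁻¹.1 x.1)) := by rw [e]
      _ = σ⁻¹.1 x.1 := by simp

/-- The group `G^Pink_{3,2,∞}`: the closure of the subgroup generated by `α₁`, `α₂`, `α₃`. -/
def GPink : Subgroup TreeAut :=
  (Subgroup.closure {alpha1, alpha2, alpha3}).topologicalClosure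

end PinkTree

namespace PinkTree

/-! `Btilde` is cut out by the local conditions `Pa = Pb = R = 0` at every node. The level sums
`levelOne`, `levelTwo` are cocycles, and `twistOne` fails to be one by a term that cancels the cross
terms of the quadratic part of `R`. Hence `Btilde` is closed under products (`mul_mem_Btilde`); it
is also topologically closed and contains the generators, so it contains `GPink`.

Conversely, whether (α, β) lies in `Btilde` depends, beyond α, β ∈ `Btilde`, only on three bits of
each at the root: `levelOne`, `levelTwo`, `twistOne`. Let G be the abstract group `pinkSubgroup` and
N = {n : (1, n) ∈ G}. Conjugation by G preserves N, and N contains τ, so modulo N only the dihedral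
group of order 8 generated by α₂ and α₃ remains; the three bits separate 1 from its other elements.
Therefore a pair of elements of G that lies in `Btilde` already lies in G (`pair_mem`).
Approximating both sections of an element of `Btilde`, with their three bits, then approximates the
element itself one level deeper (`exists_approx`), so G is dense in `Btilde`. -/

theorem zmod_two_two : (2 : ZMod 2) = 0 := rfl

theorem zmod_two_cases (p : ZMod 2) : p = 0 ∨ p = 1 := by
  revert p; decide

/-! ### Parities -/

theorem ext_apply {σ ρ : TreeAut} (h : ∀ x, σ.1 x = ρ.1 x) : σ = ρ :=
  Subtype.ext (Equiv.ext h)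

theorem mul_apply (σ ρ : TreeAut) (x : Node) : (σ * ρ).1 x = σ.1 (ρ.1 x) := rfl

theorem exists_apply_append (σ : TreeAut) (x : Node) (t : Bool) :
    ∃ u, σ.1 (x ++ [t]) = σ.1 x ++ [u] := by
  have h := σ.2.2 (x ++ [t])
  rw [List.dropLast_concat] at h
  have hne : σ.1 (x ++ [t]) ≠ [] := by simp [apply_eq_nil]
  exact ⟨(σ.1 (x ++ [t])).getLast hne, by rw [h, List.dropLast_append_getLast hne]⟩

theorem apply_append_of_par_eq_zero {σ : TreeAut} {x : Node} (h : par σ x = 0) (t : Bool) :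
    σ.1 (x ++ [t]) = σ.1 x ++ [t] := by
  have ha : σ.1 (x ++ [a]) = σ.1 x ++ [a] := by
    by_contra hc
    simp [par, hc] at h
  cases t
  · exact ha
  · obtain ⟨u, hu⟩ := exists_apply_append σ x true
    cases u
    · have := σ.1.injective (hu.trans ha.symm)
      simp at this
    · exact hu

theorem apply_append_of_par_eq_one {σ : TreeAut} {x : Node} (h : par σ x = 1) (t : Bool) :
    σ.1 (x ++ [t]) = σ.1 x ++ [!t] := by
  have hne : σ.1 (x ++ [a]) ≠ σ.1 x ++ [a] := by
    intro hc
    simp [par, hc] at h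
  have ha : σ.1 (x ++ [a]) = σ.1 x ++ [true] := by
    obtain ⟨u, hu⟩ := exists_apply_append σ x a
    cases u
    · exact absurd hu hne
    · exact hu
  cases t
  · exact ha
  · obtain ⟨u, hu⟩ := exists_apply_append σ x true
    cases u
    · exact hu
    · have := σ.1.injective (hu.trans ha.symm)
      simp at this

theorem par_mul (σ ρ : TreeAut) (x : Node) :
    par (σ * ρ) x = par σ (ρ.1 x) + par ρ x := by
  rcases zmod_two_cases (par ρ x) with h | h
  · rw [h, add_zero, par, par, mul_apply, mul_apply, apply_append_of_par_eq_zero h]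
  · rw [h, par, mul_apply, mul_apply, apply_append_of_par_eq_one h]
    rcases zmod_two_cases (par σ (ρ.1 x)) with h' | h'
    · rw [apply_append_of_par_eq_zero h', h']
      simp
    · rw [apply_append_of_par_eq_one h', h', if_pos (by simp)]
      rfl

theorem par_congr {σ ρ : TreeAut} {n : ℕ} (h : restrict n σ = restrict n ρ) {x : Node}
    (hx : x.length < n) : par σ x = par ρ x := by
  have h1 : σ.1 (x ++ [a]) = ρ.1 (x ++ [a]) := congrFun h ⟨x ++ [a], by simpa using hx⟩
  have h2 : σ.1 x = ρ.1 x := congrFun h ⟨x, hx.le⟩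
  rw [par, par, h1, h2]

theorem par_one (x : Node) : par 1 x = 0 := by simp [par]

theorem par_pair_a (α β : TreeAut) (x : Node) : par (pair α β) (false :: x) = par α x := by
  simp [par, pair, pairFun]

theorem par_pair_b (α β : TreeAut) (x : Node) : par (pair α β) (true :: x) = par β x := by
  simp [par, pair, pairFun]

theorem par_tau_cons (t : Bool) (x : Node) : par tau (t :: x) = 0 := by
  simp [par, tau, swapFun]

/-! ### Sums of parities over the levels above a node -/

/-- The sum of the parities one level above `x`. -/
def levelOne (σ : TreeAut) (x : Node) : ZMod 2 := par σ (x ++ [a]) + par σ (x ++ [b])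

/-- The sum of the parities two levels above `x`. -/
def levelTwo (σ : TreeAut) (x : Node) : ZMod 2 :=
  levelOne σ (x ++ [a]) + levelOne σ (x ++ [b])

/-- The contribution to `R` of a single node two levels up. -/
def twist (σ : TreeAut) (x : Node) : ZMod 2 :=
  par σ x + par σ (x ++ [b]) + levelOne σ (x ++ [a])

/-- The sum of the contributions `twist` one level above `x`. -/
def twistOne (σ : TreeAut) (x : Node) : ZMod 2 := twist σ (x ++ [a]) + twist σ (x ++ [b])

theorem sum_fin_one (f : Node → ZMod 2) :
    ∑ w : Fin 1 → Bool, f (List.ofFn w) = f [a] + f [b] := by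
  have : (Finset.univ : Finset (Fin 1 → Bool)) = {![a], ![b]} := by decide
  rw [this, Finset.sum_pair (by decide)]
  rfl

theorem sum_fin_two (f : Node → ZMod 2) :
    ∑ w : Fin 2 → Bool, f (List.ofFn w) = f [a, a] + f [a, b] + (f [b, a] + f [b, b]) := by
  have : (Finset.univ : Finset (Fin 2 → Bool)) = {![a, a], ![a, b], ![b, a], ![b, b]} := by
    decide
  rw [this, Finset.sum_insert (by decide), Finset.sum_insert (by decide),
    Finset.sum_pair (by decide), add_assoc]
  rfl

theorem Pa_eq (σ : TreeAut) (x : Node) :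
    Pa 3 2 σ x = levelTwo σ (x ++ [a]) + levelOne σ (x ++ [b]) := by
  have h2 := sum_fin_two fun w => par σ (x ++ [a] ++ w)
  have h1 := sum_fin_one fun w => par σ (x ++ [b] ++ w)
  have h : Pa 3 2 σ x = _ := congrArg₂ (· + ·) h2 h1
  simp only [h, levelOne, levelTwo, List.append_assoc, List.cons_append,
    List.nil_append]

theorem Pb_eq (σ : TreeAut) (x : Node) :
    Pb 3 2 σ x = levelTwo σ (x ++ [b]) + levelOne σ (x ++ [a]) := by
  have h2 := sum_fin_two fun w => par σ (x ++ [b] ++ w)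
  have h1 := sum_fin_one fun w => par σ (x ++ [a] ++ w)
  have h : Pb 3 2 σ x = _ := congrArg₂ (· + ·) h2 h1
  simp only [h, levelOne, levelTwo, List.append_assoc, List.cons_append,
    List.nil_append]

theorem R_eq (σ : TreeAut) (x : Node) :
    R σ x = twistOne σ (x ++ [a]) + twistOne σ (x ++ [b]) +
      levelOne σ (x ++ [a]) * levelOne σ (x ++ [b]) := by
  have h2 := sum_fin_two fun w =>
    (par σ (x ++ w) + par σ (x ++ w ++ [b]) + ∑ t : Bool, par σ (x ++ w ++ [a, t]))
  rw [R, h2]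
  simp only [levelOne, twistOne, twist, List.append_assoc, List.cons_append,
    List.nil_append, Fintype.sum_bool]
  ring

theorem mem_Btilde_iff (σ : TreeAut) :
    σ ∈ Btilde ↔ ∀ x, Pa 3 2 σ x = 0 ∧ Pb 3 2 σ x = 0 ∧ R σ x = 0 := by
  constructor
  · rintro ⟨⟨⟨hM, hR⟩, -, hP⟩, hR0⟩ x
    have hP : Pa 3 2 σ [] = 0 := hP
    have hR0 : R σ [] = 0 := hR0
    obtain ⟨h1, h2, h3⟩ := hM [] x
    exact ⟨by rw [← h2, ← h1, hP], by rw [← h3, ← h2, ← h1, hP], by rw [hR x [], hR0]⟩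
  · intro h
    have hM : σ ∈ M 3 2 := fun x y => by simp [h]
    exact ⟨⟨⟨hM, fun x y => by simp [h]⟩, hM, (h []).1⟩, (h []).2.2⟩

theorem levelOne_mul (σ ρ : TreeAut) (x : Node) :
    levelOne (σ * ρ) x = levelOne σ (ρ.1 x) + levelOne ρ x := by
  simp only [levelOne, par_mul]
  rcases zmod_two_cases (par ρ x) with h | h
  · simp only [apply_append_of_par_eq_zero h]
    ring
  · simp only [apply_append_of_par_eq_one h, Bool.not_false, Bool.not_true]
    ring

theorem levelTwo_mul (σ ρ : TreeAut) (x : Node) :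
    levelTwo (σ * ρ) x = levelTwo σ (ρ.1 x) + levelTwo ρ x := by
  simp only [levelTwo, levelOne_mul]
  rcases zmod_two_cases (par ρ x) with h | h
  · simp only [apply_append_of_par_eq_zero h]
    ring
  · simp only [apply_append_of_par_eq_one h, Bool.not_false, Bool.not_true]
    ring

/-- `twist` treats the letters `a` and `b` differently; exchanging them changes it by `levelOne +
levelTwo`, which is the correction where ρ swaps. -/
theorem twist_mul (σ ρ : TreeAut) (x : Node) :
    twist (σ * ρ) x = twist σ (ρ.1 x) + twist ρ x +
      par ρ x * (levelOne σ (ρ.1 x) + levelTwo σ (ρ.1 x)) := by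
  simp only [twist, levelTwo, levelOne_mul, par_mul]
  rcases zmod_two_cases (par ρ x) with h | h
  · simp only [apply_append_of_par_eq_zero h, h]
    ring
  · simp only [apply_append_of_par_eq_one h, h, Bool.not_false, Bool.not_true]
    rw [levelOne.eq_1 σ (ρ.1 x)]
    linear_combination (-par σ (ρ.1 x ++ [b]) - levelOne σ (ρ.1 x ++ [a])) * zmod_two_two

/-- The hypotheses are `Pa = Pb = 0` for σ at `ρ.1 x`. They make the correction factors of
`twist_mul` at the two children both equal to `levelTwo σ (ρ.1 x)`. -/
theorem twistOne_mul (σ ρ : TreeAut) (x : Node)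
    (ha : levelTwo σ (ρ.1 x ++ [a]) = levelOne σ (ρ.1 x ++ [b]))
    (hb : levelTwo σ (ρ.1 x ++ [b]) = levelOne σ (ρ.1 x ++ [a])) :
    twistOne (σ * ρ) x = twistOne σ (ρ.1 x) + twistOne ρ x +
      levelOne ρ x * levelTwo σ (ρ.1 x) := by
  simp only [twistOne, twist_mul]
  rw [levelOne.eq_1 ρ, levelTwo.eq_1 σ (ρ.1 x)]
  rcases zmod_two_cases (par ρ x) with h | h
  · simp only [apply_append_of_par_eq_zero h, ha, hb]
    ring
  · simp only [apply_append_of_par_eq_one h, Bool.not_false, Bool.not_true, ha, hb]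
    ring

theorem eq_of_add_eq_zero {p q : ZMod 2} (h : p + q = 0) : p = q := CharTwo.add_eq_zero.1 h

theorem mul_mem_Btilde {σ ρ : TreeAut} (hσ : σ ∈ Btilde) (hρ : ρ ∈ Btilde) :
    σ * ρ ∈ Btilde := by
  rw [mem_Btilde_iff] at *
  simp only [Pa_eq, Pb_eq, R_eq] at *
  intro x
  have key : ∀ y, levelTwo σ (y ++ [a]) = levelOne σ (y ++ [b]) ∧
      levelTwo σ (y ++ [b]) = levelOne σ (y ++ [a]) := fun y =>
    ⟨eq_of_add_eq_zero (hσ y).1, eq_of_add_eq_zero (hσ y).2.1⟩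
  simp only [levelOne_mul, levelTwo_mul, twistOne_mul σ ρ _ (key _).1 (key _).2]
  obtain ⟨h1, h2, h3⟩ := hσ (ρ.1 x)
  obtain ⟨h4, h5, h6⟩ := hρ x
  obtain ⟨h7, h8⟩ := key (ρ.1 x)
  rcases zmod_two_cases (par ρ x) with h | h
  · simp only [apply_append_of_par_eq_zero h]
    refine ⟨by linear_combination h1 + h4, by linear_combination h2 + h5, ?_⟩
    -- The corrections from `twistOne_mul` now coincide with the cross terms of the product of the
    -- two `levelOne` sums, so they cancel modulo 2.
    rw [h7, h8]
    linear_combination h3 + h6 + (levelOne σ (ρ.1 x ++ [a]) * levelOne ρ (x ++ [b]) +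
      levelOne σ (ρ.1 x ++ [b]) * levelOne ρ (x ++ [a])) * zmod_two_two
  · simp only [apply_append_of_par_eq_one h, Bool.not_false, Bool.not_true]
    refine ⟨by linear_combination h2 + h4, by linear_combination h1 + h5, ?_⟩
    rw [h7, h8]
    linear_combination h3 + h6 + (levelOne σ (ρ.1 x ++ [a]) * levelOne ρ (x ++ [a]) +
      levelOne σ (ρ.1 x ++ [b]) * levelOne ρ (x ++ [b])) * zmod_two_two

/-! ### Pairs -/

theorem pair_mul (α β γ δ : TreeAut) : pair α β * pair γ δ = pair (α * γ) (β * δ) := by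
  apply ext_apply
  rintro (_ | ⟨_ | _, w⟩) <;> rfl

theorem pair_one_one : pair 1 1 = 1 := by
  apply ext_apply
  rintro (_ | ⟨_ | _, w⟩) <;> rfl

theorem pair_inv (α β : TreeAut) : (pair α β)⁻¹ = pair α⁻¹ β⁻¹ := by
  rw [inv_eq_iff_mul_eq_one, pair_mul, mul_inv_cancel, mul_inv_cancel, pair_one_one]

theorem tau_mul_tau : tau * tau = 1 := by
  apply ext_apply
  rintro (_ | ⟨_ | _, w⟩) <;> rfl

theorem tau_mul_pair_mul_tau (α β : TreeAut) : tau * pair α β * tau = pair β α := by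
  apply ext_apply
  rintro (_ | ⟨_ | _, w⟩) <;> rfl

/-- The conditions at nodes other than the root are those of the sections; the condition at the root
sees only the three invariants of each section. -/
theorem pair_mem_Btilde_iff (α β : TreeAut) : pair α β ∈ Btilde ↔
    α ∈ Btilde ∧ β ∈ Btilde ∧ levelTwo α [] = levelOne β [] ∧ levelTwo β [] = levelOne α [] ∧
      twistOne α [] + twistOne β [] + levelOne α [] * levelOne β [] = 0 := by
  simp only [mem_Btilde_iff, Pa_eq, Pb_eq, R_eq, levelTwo, twistOne, levelOne, twist]
  constructor
  · intro h
    have h0 := h []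
    simp only [List.nil_append, List.cons_append, par_pair_a, par_pair_b] at h0
    refine ⟨fun x => ?_, fun x => ?_, ?_⟩
    · simpa only [List.cons_append, par_pair_a] using h (a :: x)
    · simpa only [List.cons_append, par_pair_b] using h (b :: x)
    · exact ⟨eq_of_add_eq_zero h0.1, eq_of_add_eq_zero h0.2.1, h0.2.2⟩
  · rintro ⟨hα, hβ, h1, h2, h3⟩ (_ | ⟨_ | _, x⟩)
    · simp only [List.nil_append, List.cons_append, par_pair_a, par_pair_b] at h1 h2 h3 ⊢
      exact ⟨CharTwo.add_eq_zero.2 h1, CharTwo.add_eq_zero.2 h2, h3⟩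
    · simpa only [List.cons_append, par_pair_a] using hα x
    · simpa only [List.cons_append, par_pair_b] using hβ x

theorem one_mem_Btilde : (1 : TreeAut) ∈ Btilde := by
  simp [mem_Btilde_iff, Pa_eq, Pb_eq, R_eq, levelTwo, twistOne, levelOne, twist, par_one]

theorem par_tau_append (x : Node) (t : Bool) : par tau (x ++ [t]) = 0 := by
  cases x <;> exact par_tau_cons _ _

theorem tau_mem_Btilde : tau ∈ Btilde := by
  simp only [mem_Btilde_iff, Pa_eq, Pb_eq, R_eq, levelTwo, twistOne, levelOne, twist,
    par_tau_append]
  simp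

theorem alpha2_mem_Btilde : alpha2 ∈ Btilde :=
  (pair_mem_Btilde_iff _ _).2
    ⟨tau_mem_Btilde, one_mem_Btilde, by decide, by decide, by decide⟩

theorem alpha3_eq_pair : alpha3 = pair alpha2 alpha3 := (eq_pair_iff_eq_alpha3 _).2 rfl

theorem alpha3_mem_Btilde : alpha3 ∈ Btilde := by
  rw [mem_Btilde_iff]
  have h2 := (mem_Btilde_iff _).1 alpha2_mem_Btilde
  simp only [Pa_eq, Pb_eq, R_eq, levelTwo, twistOne, levelOne, twist] at h2 ⊢
  intro x
  induction x with
  | nil => decide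
  | cons t x ih =>
    rw [alpha3_eq_pair]
    cases t
    · simpa only [List.cons_append, par_pair_a] using h2 x
    · simpa only [List.cons_append, par_pair_b] using ih

/-! ### The group generated by `α₁`, `α₂`, `α₃` -/

/-- The (abstract) subgroup generated by `α₁`, `α₂`, `α₃`. -/
def pinkSubgroup : Subgroup TreeAut := Subgroup.closure {alpha1, alpha2, alpha3}

theorem tau_mem : tau ∈ pinkSubgroup := Subgroup.subset_closure (by simp [alpha1])

theorem alpha2_mem : alpha2 ∈ pinkSubgroup := Subgroup.subset_closure (by simp)

theorem alpha3_mem : alpha3 ∈ pinkSubgroup := Subgroup.subset_closure (by simp)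

theorem alpha2_mul_self : alpha2 * alpha2 = 1 := ext_apply alpha2_alpha2

theorem alpha3_mul_self : alpha3 * alpha3 = 1 := ext_apply alpha3Fun_alpha3Fun

theorem pinkSubgroup_induction {p : TreeAut → Prop} (one : p 1)
    (h1 : ∀ g ∈ pinkSubgroup, p g → p (tau * g))
    (h2 : ∀ g ∈ pinkSubgroup, p g → p (alpha2 * g))
    (h3 : ∀ g ∈ pinkSubgroup, p g → p (alpha3 * g)) {g : TreeAut} (hg : g ∈ pinkSubgroup) :
    p g := by
  induction hg using Subgroup.closure_induction_left with
  | one => exact one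
  | mul_left s hs g hg ih =>
    rcases hs with rfl | rfl | rfl
    exacts [h1 _ hg ih, h2 _ hg ih, h3 _ hg ih]
  | inv_mul_cancel s hs g hg ih =>
    rcases hs with rfl | rfl | rfl
    · rw [alpha1, inv_eq_of_mul_eq_one_left tau_mul_tau]
      exact h1 _ hg ih
    · rw [inv_eq_of_mul_eq_one_left alpha2_mul_self]
      exact h2 _ hg ih
    · rw [inv_eq_of_mul_eq_one_left alpha3_mul_self]
      exact h3 _ hg ih

theorem pinkSubgroup_le_Btilde {g : TreeAut} (hg : g ∈ pinkSubgroup) : g ∈ Btilde :=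
  pinkSubgroup_induction one_mem_Btilde (fun _ _ h => mul_mem_Btilde tau_mem_Btilde h)
    (fun _ _ h => mul_mem_Btilde alpha2_mem_Btilde h)
    (fun _ _ h => mul_mem_Btilde alpha3_mem_Btilde h) hg

theorem pair_swap_mem {α β : TreeAut} (h : pair α β ∈ pinkSubgroup) :
    pair β α ∈ pinkSubgroup := by
  rw [← tau_mul_pair_mul_tau]
  exact mul_mem (mul_mem tau_mem h) tau_mem

theorem pair_alpha2_alpha3_mem : pair alpha2 alpha3 ∈ pinkSubgroup :=
  alpha3_eq_pair ▸ alpha3_mem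

/-- The generators τ, α₂, α₃ are the first coordinates of α₂ = (τ, 1), α₃ = (α₂, α₃) and τα₃τ = (α₃,
α₂). -/
theorem exists_pair_mem {g : TreeAut} (hg : g ∈ pinkSubgroup) :
    ∃ h ∈ pinkSubgroup, pair g h ∈ pinkSubgroup := by
  refine pinkSubgroup_induction (p := fun g => ∃ h ∈ pinkSubgroup, pair g h ∈ pinkSubgroup)
    ?_ ?_ ?_ ?_ hg
  · exact ⟨1, one_mem _, by rw [pair_one_one]; exact one_mem _⟩
  · rintro g - ⟨h, hh, hp⟩
    exact ⟨1 * h, by simpa using hh, by rw [← pair_mul]; exact mul_mem alpha2_mem hp⟩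
  · rintro g - ⟨h, hh, hp⟩
    exact ⟨alpha3 * h, mul_mem alpha3_mem hh, by
      rw [← pair_mul]; exact mul_mem pair_alpha2_alpha3_mem hp⟩
  · rintro g - ⟨h, hh, hp⟩
    exact ⟨alpha2 * h, mul_mem alpha2_mem hh, by
      rw [← pair_mul]; exact mul_mem (pair_swap_mem pair_alpha2_alpha3_mem) hp⟩

theorem pair_one_conj_mem {g n : TreeAut} (hg : g ∈ pinkSubgroup)
    (hn : pair 1 n ∈ pinkSubgroup) : pair 1 (g * n * g⁻¹) ∈ pinkSubgroup := by
  obtain ⟨h, -, hp⟩ := exists_pair_mem hg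
  have hp := pair_swap_mem hp
  have := mul_mem (mul_mem hp hn) (inv_mem hp)
  rwa [pair_inv, pair_mul, pair_mul, mul_one, mul_inv_cancel] at this

/-- In the second coordinate α₂ is trivial, so the relation reduces to the first, where it says that
(τ, 1) commutes with (1, τ). -/
theorem alpha2_alpha3_braid :
    alpha3 * (alpha2 * (alpha3 * alpha2)) = alpha2 * (alpha3 * (alpha2 * alpha3)) := by
  have h : alpha2 * (tau * (alpha2 * tau)) = tau * (alpha2 * (tau * alpha2)) := by
    apply ext_apply
    rintro (_ | ⟨_ | _, _ | ⟨_ | _, w⟩⟩) <;> rfl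
  have key : ∀ β, pair alpha2 β * (pair tau 1 * (pair alpha2 β * pair tau 1)) =
      pair tau 1 * (pair alpha2 β * (pair tau 1 * pair alpha2 β)) := fun β => by
    simp only [pair_mul, one_mul, mul_one, h]
  have := key alpha3
  rwa [← alpha3_eq_pair] at this

/-- The words in `α₂`, `α₃` which represent the elements of the dihedral group they generate. -/
def dihedralWords : List TreeAut :=
  [1, alpha2, alpha3, alpha2 * alpha3, alpha3 * alpha2, alpha2 * (alpha3 * alpha2),
    alpha3 * (alpha2 * alpha3), alpha2 * (alpha3 * (alpha2 * alpha3))]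

theorem alpha2_mul_mem_dihedralWords {q : TreeAut} (hq : q ∈ dihedralWords) :
    alpha2 * q ∈ dihedralWords := by
  have h : ∀ x, alpha2 * (alpha2 * x) = x := fun x => by
    rw [← mul_assoc, alpha2_mul_self, one_mul]
  simp only [dihedralWords, List.mem_cons, List.not_mem_nil, or_false] at hq
  rcases hq with rfl | rfl | rfl | rfl | rfl | rfl | rfl | rfl <;>
    simp [dihedralWords, h, alpha2_mul_self]

theorem alpha3_mul_mem_dihedralWords {q : TreeAut} (hq : q ∈ dihedralWords) :
    alpha3 * q ∈ dihedralWords := by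
  have h : ∀ x, alpha3 * (alpha3 * x) = x := fun x => by
    rw [← mul_assoc, alpha3_mul_self, one_mul]
  have h' := alpha2_alpha3_braid
  -- Prepares the one case not covered by direct rewriting: α₃ times the longest word, which must
  -- first be read as starting with α₃.
  have h'' := h (alpha2 * (alpha3 * alpha2))
  rw [h'] at h''
  simp only [dihedralWords, List.mem_cons, List.not_mem_nil, or_false] at hq
  rcases hq with rfl | rfl | rfl | rfl | rfl | rfl | rfl | rfl <;>
    simp [dihedralWords, h, h', h'', alpha3_mul_self]

/-- τ is absorbed into the left factor because (1, τ) lies in the subgroup; α₂ and α₃ are moved past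
that factor by conjugation. -/
theorem exists_eq_mul_dihedralWord {g : TreeAut} (hg : g ∈ pinkSubgroup) :
    ∃ n, pair 1 n ∈ pinkSubgroup ∧ ∃ q ∈ dihedralWords, g = n * q := by
  refine pinkSubgroup_induction
    (p := fun g => ∃ n, pair 1 n ∈ pinkSubgroup ∧ ∃ q ∈ dihedralWords, g = n * q) ?_ ?_ ?_ ?_ hg
  · exact ⟨1, by rw [pair_one_one]; exact one_mem _, 1, by simp [dihedralWords], by simp⟩
  · rintro _ - ⟨n, hn, q, hq, rfl⟩
    refine ⟨tau * n, ?_, q, hq, by rw [mul_assoc]⟩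
    have := mul_mem (pair_swap_mem alpha2_mem) hn
    rwa [pair_mul, one_mul] at this
  · rintro _ - ⟨n, hn, q, hq, rfl⟩
    exact ⟨_, pair_one_conj_mem alpha2_mem hn, _, alpha2_mul_mem_dihedralWords hq, by group⟩
  · rintro _ - ⟨n, hn, q, hq, rfl⟩
    exact ⟨_, pair_one_conj_mem alpha3_mem hn, _, alpha3_mul_mem_dihedralWords hq, by group⟩

theorem pair_mem_Btilde_invariants {β : TreeAut} (h : pair 1 β ∈ Btilde) :
    levelOne β [] = 0 ∧ levelTwo β [] = 0 ∧ twistOne β [] = 0 := by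
  obtain ⟨-, -, h1, h2, h3⟩ := (pair_mem_Btilde_iff _ _).1 h
  simp only [levelTwo, levelOne, twistOne, twist, par_one, add_zero, zero_add,
    zero_mul] at h1 h2 h3 ⊢
  exact ⟨h1.symm, h2, h3⟩

theorem eq_one_of_dihedralWord {q : TreeAut} (hq : q ∈ dihedralWords)
    (h : levelOne q [] = 0 ∧ levelTwo q [] = 0 ∧ twistOne q [] = 0) : q = 1 := by
  simp only [dihedralWords, List.mem_cons, List.not_mem_nil, or_false] at hq
  rcases hq with rfl | rfl | rfl | rfl | rfl | rfl | rfl | rfl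
  · rfl
  all_goals exact absurd h (by decide)

/-- Every triple of invariants is attained by an element of the subgroup. -/
theorem exists_mem_invariants (p q r : ZMod 2) : ∃ g ∈ pinkSubgroup,
    par g [] = 0 ∧ levelOne g [] = p ∧ levelTwo g [] = q ∧ twistOne g [] = r := by
  have key : ∃ g ∈ dihedralWords,
      par g [] = 0 ∧ levelOne g [] = p ∧ levelTwo g [] = q ∧ twistOne g [] = r := by
    rcases zmod_two_cases p with rfl | rfl <;> rcases zmod_two_cases q with rfl | rfl <;>
      rcases zmod_two_cases r with rfl | rfl
    · exact ⟨1, by simp [dihedralWords], by decide⟩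
    · exact ⟨alpha2 * (alpha3 * (alpha2 * alpha3)), by simp [dihedralWords], by decide⟩
    · exact ⟨alpha2 * (alpha3 * alpha2), by simp [dihedralWords], by decide⟩
    · exact ⟨alpha3, by simp [dihedralWords], by decide⟩
    · exact ⟨alpha3 * (alpha2 * alpha3), by simp [dihedralWords], by decide⟩
    · exact ⟨alpha2, by simp [dihedralWords], by decide⟩
    · exact ⟨alpha2 * alpha3, by simp [dihedralWords], by decide⟩
    · exact ⟨alpha3 * alpha2, by simp [dihedralWords], by decide⟩
  obtain ⟨g, hg, h⟩ := key
  refine ⟨g, ?_, h⟩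
  simp only [dihedralWords, List.mem_cons, List.not_mem_nil, or_false] at hg
  have h2 := alpha2_mem
  have h3 := alpha3_mem
  rcases hg with rfl | rfl | rfl | rfl | rfl | rfl | rfl | rfl
  · exact one_mem _
  all_goals repeat' first | assumption | apply mul_mem

/-- Dividing by (1, n) leaves (1, q) in `Btilde` with q a dihedral word; its invariants vanish,
which forces q = 1. -/
theorem pair_one_mem {g : TreeAut} (hg : g ∈ pinkSubgroup) (h : pair 1 g ∈ Btilde) :
    pair 1 g ∈ pinkSubgroup := by
  obtain ⟨n, hn, q, hq, rfl⟩ := exists_eq_mul_dihedralWord hg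
  have hq' := mul_mem_Btilde (pinkSubgroup_le_Btilde (inv_mem hn)) h
  rw [pair_inv, pair_mul, inv_mul_cancel_left, inv_one, one_mul] at hq'
  rw [eq_one_of_dihedralWord hq (pair_mem_Btilde_invariants hq'), mul_one]
  exact hn

theorem pair_mem {g h : TreeAut} (hg : g ∈ pinkSubgroup) (hh : h ∈ pinkSubgroup)
    (hgh : pair g h ∈ Btilde) : pair g h ∈ pinkSubgroup := by
  obtain ⟨k, hk, hp⟩ := exists_pair_mem hg
  have h1 := mul_mem_Btilde (pinkSubgroup_le_Btilde (inv_mem hp)) hgh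
  rw [pair_inv, pair_mul, inv_mul_cancel] at h1
  -- (g, h) = (g, k)(1, k⁻¹h).
  have h2 := mul_mem hp (pair_one_mem (mul_mem (inv_mem hk) hh) h1)
  rwa [pair_mul, mul_one, mul_inv_cancel_left] at h2

/-! ### Sections -/

theorem exists_apply_cons {σ : TreeAut} (h : par σ [] = 0) (t : Bool) (x : Node) :
    ∃ y, σ.1 (t :: x) = t :: y := by
  induction x using List.reverseRecOn with
  | nil =>
    have := apply_append_of_par_eq_zero h t
    rw [σ.2.1] at this
    exact ⟨[], this⟩
  | append_singleton x u ih =>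
    obtain ⟨y, hy⟩ := ih
    obtain ⟨v, hv⟩ := exists_apply_append σ (t :: x) u
    exact ⟨y ++ [v], by rw [← List.cons_append, hv, hy, List.cons_append]⟩

theorem par_inv_nil {σ : TreeAut} (h : par σ [] = 0) : par σ⁻¹ [] = 0 := by
  have := par_mul σ σ⁻¹ []
  rwa [mul_inv_cancel, par_one, σ⁻¹.2.1, h, zero_add, eq_comm] at this

theorem apply_cons_eq {σ : TreeAut} (h : par σ [] = 0) (t : Bool) (x : Node) :
    σ.1 (t :: x) = t :: (σ.1 (t :: x)).tail := by
  obtain ⟨y, hy⟩ := exists_apply_cons h t x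
  rw [hy, List.tail_cons]

/-- The action of an automorphism that fixes the nodes of length one on the subtree above the
node `[t]`. -/
def branch (σ : TreeAut) (h : par σ [] = 0) (t : Bool) : TreeAut :=
  ⟨{ toFun := fun x => (σ.1 (t :: x)).tail
     invFun := fun x => (σ⁻¹.1 (t :: x)).tail
     left_inv := fun x => by
      dsimp only
      rw [← apply_cons_eq h, show σ⁻¹.1 (σ.1 (t :: x)) = t :: x by simp, List.tail_cons]
     right_inv := fun x => by
      dsimp only
      rw [← apply_cons_eq (par_inv_nil h), show σ.1 (σ⁻¹.1 (t :: x)) = t :: x by simp,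
        List.tail_cons] }, by
    refine ⟨?_, fun x => ?_⟩
    · have := length_apply σ [t]
      rw [← List.length_eq_zero_iff]
      simp [this]
    · rcases List.eq_nil_or_concat x with rfl | ⟨x, u, rfl⟩
      · have := length_apply σ [t]
        have h0 : (σ.1 [t]).tail = [] := by
          rw [← List.length_eq_zero_iff]
          simp [this]
        simp [h0]
      · obtain ⟨y, hy⟩ := exists_apply_cons h t x
        obtain ⟨v, hv⟩ := exists_apply_append σ (t :: x) u
        rw [hy] at hv
        simp only [List.cons_append] at hv
        simp [hy, hv]⟩

theorem eq_pair_branch {σ : TreeAut} (h : par σ [] = 0) :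
    σ = pair (branch σ h a) (branch σ h b) := by
  apply ext_apply
  rintro (_ | ⟨_ | _, x⟩)
  · exact σ.2.1
  · exact apply_cons_eq h a x
  · exact apply_cons_eq h b x

/-! ### Approximation -/

theorem restrict_eq_iff {n : ℕ} {σ ρ : TreeAut} :
    restrict n σ = restrict n ρ ↔ ∀ x : Node, x.length ≤ n → σ.1 x = ρ.1 x :=
  ⟨fun h x hx => congrFun h ⟨x, hx⟩, fun h => funext fun x => h x.1 x.2⟩

theorem restrict_pair {n : ℕ} {α β γ δ : TreeAut} (h : restrict n α = restrict n γ)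
    (h' : restrict n β = restrict n δ) :
    restrict (n + 1) (pair α β) = restrict (n + 1) (pair γ δ) := by
  rw [restrict_eq_iff] at *
  rintro (_ | ⟨_ | _, x⟩) hx
  · rfl
  · exact congrArg (List.cons a) (h x (by simpa using hx))
  · exact congrArg (List.cons b) (h' x (by simpa using hx))

theorem restrict_mul_left {n : ℕ} {σ ρ : TreeAut} (τ : TreeAut)
    (h : restrict n σ = restrict n ρ) : restrict n (τ * σ) = restrict n (τ * ρ) := by
  rw [restrict_eq_iff] at *
  intro x hx
  rw [mul_apply, mul_apply, h x hx]

/-- `σ` and `ρ` agree up to level `n` and have the same invariants at the root. -/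
def Approx (n : ℕ) (σ ρ : TreeAut) : Prop :=
  restrict n σ = restrict n ρ ∧ levelOne σ [] = levelOne ρ [] ∧
    levelTwo σ [] = levelTwo ρ [] ∧ twistOne σ [] = twistOne ρ []

theorem twistOne_congr {n : ℕ} {σ ρ : TreeAut} (h : restrict (n + 4) σ = restrict (n + 4) ρ) :
    twistOne σ [] = twistOne ρ [] := by
  have h1 : ∀ t, par σ [t] = par ρ [t] := fun t => par_congr h (by simp)
  have h2 : ∀ t u, par σ [t, u] = par ρ [t, u] := fun t u => par_congr h (by simp)
  have h3 : ∀ t u v, par σ [t, u, v] = par ρ [t, u, v] := fun t u v => par_congr h (by simp)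
  simp only [twistOne, twist, levelOne, List.nil_append, List.cons_append, h1, h2, h3]

/-- An element of the subgroup which is trivial up to level three, and on which `twistOne` does not
vanish. -/
def corrector : TreeAut :=
  alpha2 * (tau * alpha3 * tau * alpha2 * (tau * alpha3 * tau))

theorem corrector_mem : corrector ∈ pinkSubgroup := by
  have h1 := tau_mem
  have h2 := alpha2_mem
  have h3 := alpha3_mem
  unfold corrector
  repeat' first | assumption | apply mul_mem

/-- `corrector` equals ((α₃α₂, α₂α₃), 1), and both α₃α₂ and α₂α₃ fix the nodes of length one. -/
theorem corrector_apply {x : Node} (hx : x.length ≤ 3) : corrector.1 x = x := by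
  rcases x with _ | ⟨t, _ | ⟨u, _ | ⟨v, _ | ⟨w, x⟩⟩⟩⟩
  · rfl
  · revert t; decide
  · revert t u; decide
  · revert t u v; decide
  · simp at hx; omega

theorem restrict_mul_corrector (g : TreeAut) {n : ℕ} (hn : n ≤ 3) :
    restrict n (g * corrector) = restrict n g := by
  rw [restrict_eq_iff]
  intro x hx
  rw [mul_apply, corrector_apply (hx.trans hn)]

theorem invariants_mul_corrector (g : TreeAut) :
    levelOne (g * corrector) [] = levelOne g [] ∧ levelTwo (g * corrector) [] = levelTwo g [] ∧
      twistOne (g * corrector) [] = twistOne g [] + 1 := by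
  refine ⟨?_, ?_, ?_⟩
  · rw [levelOne_mul, corrector_apply (by simp), show levelOne corrector [] = 0 by decide,
      add_zero]
  · rw [levelTwo_mul, corrector_apply (by simp), show levelTwo corrector [] = 0 by decide,
      add_zero]
  · have h : twistOne corrector [] = 1 := by decide
    -- Here g is arbitrary, so `twistOne_mul` is not available; instead the corrections in
    -- `twist_mul` vanish because `corrector` has zero parity on level one.
    have e : ∀ t, par corrector ([] ++ [t]) = 0 := by decide
    simp only [twistOne, twist_mul, e, zero_mul, add_zero] at h ⊢
    rw [corrector_apply (by simp), corrector_apply (by simp)]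
    linear_combination h

theorem levelOne_pair (α β : TreeAut) : levelOne (pair α β) [] = par α [] + par β [] := by
  simp only [levelOne, List.nil_append, par_pair_a, par_pair_b]

theorem levelTwo_pair (α β : TreeAut) :
    levelTwo (pair α β) [] = levelOne α [] + levelOne β [] := by
  simp only [levelTwo, levelOne, List.nil_append, List.cons_append, par_pair_a, par_pair_b]

/-- The induction carries the invariants because agreement on finitely many levels alone need not
put the pair of approximations in `Btilde`. -/
theorem exists_approx_of_par_eq_zero {n : ℕ}
    (ih : ∀ σ ∈ Btilde, ∃ g ∈ pinkSubgroup, Approx (n + 1) g σ) {σ : TreeAut}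
    (hσ : σ ∈ Btilde) (h : par σ [] = 0) : ∃ g ∈ pinkSubgroup, Approx (n + 2) g σ := by
  obtain ⟨α, β, rfl⟩ : ∃ α β, σ = pair α β := ⟨_, _, eq_pair_branch h⟩
  obtain ⟨hα, hβ, hσ'⟩ := (pair_mem_Btilde_iff _ _).1 hσ
  obtain ⟨g, hg, hgr, hg1, hg2, hg3⟩ := ih α hα
  obtain ⟨k, hk, hkr, hk1, hk2, hk3⟩ := ih β hβ
  have hm : pair g k ∈ pinkSubgroup := pair_mem hg hk <| (pair_mem_Btilde_iff _ _).2
    ⟨pinkSubgroup_le_Btilde hg, pinkSubgroup_le_Btilde hk, by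
      rwa [hg1, hg2, hg3, hk1, hk2, hk3]⟩
  have hr := restrict_pair hgr hkr
  have h1 : levelOne (pair g k) [] = levelOne (pair α β) [] := by
    rw [levelOne_pair, levelOne_pair, par_congr hgr (by simp), par_congr hkr (by simp)]
  have h2 : levelTwo (pair g k) [] = levelTwo (pair α β) [] := by
    rw [levelTwo_pair, levelTwo_pair, hg1, hk1]
  by_cases h3 : twistOne (pair g k) [] = twistOne (pair α β) []
  · exact ⟨_, hm, hr, h1, h2, h3⟩
  -- `twistOne` at the root is determined by the action on level four, so a mismatch can occur only
  -- on shallower levels, where `corrector` acts trivially.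
  · have hn : n + 2 ≤ 3 := by
      by_contra hn
      obtain ⟨m, rfl⟩ : ∃ m, n = m + 2 := ⟨n - 2, by omega⟩
      exact h3 (twistOne_congr hr)
    obtain ⟨c1, c2, c3⟩ := invariants_mul_corrector (pair g k)
    refine ⟨_, mul_mem hm corrector_mem, (restrict_mul_corrector _ hn).trans hr, c1.trans h1,
      c2.trans h2, c3.trans ?_⟩
    revert h3
    generalize twistOne (pair g k) [] = p
    generalize twistOne (pair α β) [] = q
    revert p q
    decide

theorem invariants_tau_mul (g : TreeAut) :
    levelOne (tau * g) [] = levelOne g [] ∧ levelTwo (tau * g) [] = levelTwo g [] ∧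
      twistOne (tau * g) [] = twistOne g [] := by
  rw [levelOne_mul, levelTwo_mul, twistOne_mul, g.2.1]
  · rw [show levelOne tau [] = 0 by decide, show levelTwo tau [] = 0 by decide,
      show twistOne tau [] = 0 by decide]
    simp
  all_goals
    rw [g.2.1]
    decide

theorem Approx.tau_mul {n : ℕ} {σ ρ : TreeAut} (h : Approx n σ ρ) :
    Approx n (tau * σ) (tau * ρ) := by
  obtain ⟨h0, h1, h2, h3⟩ := h
  obtain ⟨a1, a2, a3⟩ := invariants_tau_mul σ
  obtain ⟨b1, b2, b3⟩ := invariants_tau_mul ρ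
  exact ⟨restrict_mul_left _ h0, by rw [a1, b1, h1], by rw [a2, b2, h2], by rw [a3, b3, h3]⟩

theorem tau_mul_tau_mul (σ : TreeAut) : tau * (tau * σ) = σ := by
  rw [← mul_assoc, tau_mul_tau, one_mul]

theorem exists_approx_of_forall_par_eq_zero {n : ℕ}
    (h : ∀ σ ∈ Btilde, par σ [] = 0 → ∃ g ∈ pinkSubgroup, Approx n g σ) {σ : TreeAut}
    (hσ : σ ∈ Btilde) : ∃ g ∈ pinkSubgroup, Approx n g σ := by
  rcases zmod_two_cases (par σ []) with h0 | h1
  · exact h σ hσ h0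
  · obtain ⟨g, hg, hgσ⟩ := h (tau * σ) (mul_mem_Btilde tau_mem_Btilde hσ) (by
      rw [par_mul, σ.2.1, h1]
      decide)
    exact ⟨tau * g, mul_mem tau_mem hg, tau_mul_tau_mul σ ▸ hgσ.tau_mul⟩

theorem restrict_one_of_par_eq_zero {σ ρ : TreeAut} (hσ : par σ [] = 0) (hρ : par ρ [] = 0) :
    restrict 1 σ = restrict 1 ρ := by
  rw [restrict_eq_iff]
  rintro (_ | ⟨t, _ | ⟨u, x⟩⟩) hx
  · rw [σ.2.1, ρ.2.1]
  · have h1 := apply_append_of_par_eq_zero hσ t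
    have h2 := apply_append_of_par_eq_zero hρ t
    rw [σ.2.1] at h1
    rw [ρ.2.1] at h2
    exact h1.trans h2.symm
  · simp at hx

theorem exists_approx (n : ℕ) : ∀ σ ∈ Btilde, ∃ g ∈ pinkSubgroup, Approx (n + 1) g σ := by
  induction n with
  | zero =>
    refine fun σ hσ => exists_approx_of_forall_par_eq_zero (fun σ _ h0 => ?_) hσ
    obtain ⟨g, hg, h, h'⟩ :=
      exists_mem_invariants (levelOne σ []) (levelTwo σ []) (twistOne σ [])
    exact ⟨g, hg, restrict_one_of_par_eq_zero h h0, h'⟩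
  | succ n ih =>
    exact fun σ hσ => exists_approx_of_forall_par_eq_zero
      (fun σ hσ h0 => exists_approx_of_par_eq_zero ih hσ h0) hσ

/-! ### The closure -/

theorem restrict_mono {m n : ℕ} (hmn : m ≤ n) {σ ρ : TreeAut}
    (h : restrict n σ = restrict n ρ) : restrict m σ = restrict m ρ := by
  rw [restrict_eq_iff] at *
  exact fun x hx => h x (hx.trans hmn)

theorem tendsto_of_restrict_eq {f : ℕ → TreeAut} {σ : TreeAut}
    (h : ∀ n, restrict n (f n) = restrict n σ) :
    Filter.Tendsto f Filter.atTop (nhds σ) := by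
  rw [nhds_iInf, Filter.tendsto_iInf]
  intro n
  rw [@nhds_induced _ _ ⊥, Filter.tendsto_comap_iff]
  let _ : TopologicalSpace ({x : Node // x.length ≤ n} → Node) := ⊥
  refine tendsto_nhds_of_eventually_eq ?_
  filter_upwards [Filter.eventually_ge_atTop n] with m hm
  exact restrict_mono hm (h m)

theorem mem_closure_iff_restrict {s : Set TreeAut} {σ : TreeAut} :
    σ ∈ closure s ↔ ∀ n, ∃ g ∈ s, restrict n g = restrict n σ := by
  constructor
  · intro h n
    obtain ⟨g, hg, hgs⟩ := mem_closure_iff.1 h _ (isOpen_eqOn n σ) rfl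
    exact ⟨g, hgs, hg⟩
  · intro h
    choose f hf hfr using h
    exact mem_closure_of_tendsto (tendsto_of_restrict_eq hfr) (Filter.Eventually.of_forall hf)

theorem isClosed_Btilde : IsClosed Btilde := by
  refine isClosed_of_closure_subset fun σ hσ => (mem_Btilde_iff _).2 fun x => ?_
  -- `R` reads parities up to four levels above x, and a parity involves one further level.
  obtain ⟨g, hg, hgσ⟩ := mem_closure_iff_restrict.1 hσ (x.length + 5)
  have hg := (mem_Btilde_iff _).1 hg x
  have h : ∀ y : Node, y.length < 5 → par g (x ++ y) = par σ (x ++ y) := fun y hy =>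
    par_congr hgσ (by simpa using hy)
  simpa only [Pa_eq, Pb_eq, R_eq, levelTwo, twistOne, levelOne, twist, List.append_assoc,
    List.cons_append, List.nil_append, h, List.length_cons, List.length_nil, Nat.reduceAdd,
    Nat.reduceLT] using hg

end PinkTree

theorem theorem5p8 : (PinkTree.GPink : Set PinkTree.TreeAut) = PinkTree.Btilde := by
  have h : (PinkTree.GPink : Set PinkTree.TreeAut) =
      closure (PinkTree.pinkSubgroup : Set PinkTree.TreeAut) := rfl
  rw [h]
  refine Set.Subset.antisymm
    (closure_minimal (fun g hg => PinkTree.pinkSubgroup_le_Btilde hg) PinkTree.isClosed_Btilde)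
    fun σ hσ => PinkTree.mem_closure_iff_restrict.2 fun n => ?_
  obtain ⟨g, hg, hgσ⟩ := PinkTree.exists_approx n σ hσ
  exact ⟨g, hg, PinkTree.restrict_mono n.le_succ hgσ.1⟩
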